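/- **Theorem (generalised Kato--Rellich theorem).** Let $X$ and $Y$ be complex Banach spaces, let $U\subset X$ be open and connected, and for each $\beta\in U$ let $T(\beta)$ be a linear operator with domain $\mathcal D(T(\beta))\subset Y$ and values in $Y$. Here $\rho(T)$ is the set of $\lambda\in\mathbb C$ for which $T-\lambda:\mathcal D(T)\to Y$ is bijective with bounded inverse, and $\sigma(T)=\mathbb C\setminus\rho(T)$. Suppose that $T(\cdot)$ is an analytic family in the sense of Kato, that is: 1. for every $\beta\in U$ the operator $T(\beta)$ is closed and $\rho(T(\beta))\neq\emptyset$; 2. for every $\beta_1\in U$ there are $\lambda_1\in\rho(T(\beta_1))$ and an open neighbourhood $V\subset U$ of $\beta_1$ such that $\lambda_1\in\rho(T(\beta))$ for all $\beta\in V$, and $\beta\mapsto(T(\beta)-\lambda_1)^{-1}$ is an analytic map from $V$ to the bounded operators on $Y$. An eigenvalue $E$ of a closed operator $T$ is called isolated and non-degenerate if, for some $r>0$, $\{\lambda:|\lambda-E|\le r\}\cap\sigma(T)=\{E\}$ and the spectral projection $-\frac1{2\pi i}\oint_{|\lambda-E|=r}(T-\lambda)^{-1}\,d\lambda$ has one-dimensional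 range. Let $\beta_0\in U$ and let $E_0$ be an isolated, non-degenerate eigenvalue of $T(\beta_0)$. Then there are $r>0$, an open neighbourhood $W\subset U$ of $\beta_0$, and analytic maps $E:W\to\mathbb C$ and $\psi:W\to Y$ with $E(\beta_0)=E_0$ such that, for every $\beta\in W$, 1. $\sigma(T(\beta))\cap\{\lambda:|\lambda-E_0|<r\}=\{E(\beta)\}$, and $E(\beta)$ is an isolated, non-degenerate eigenvalue of $T(\beta)$; 2. $\psi(\beta)\neq0$, $\psi(\beta)\in\mathcal D(T(\beta))$ and $T(\beta)\psi(\beta)=E(\beta)\psi(\beta)$. -/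

import Mathlib

noncomputable section

namespace KatoRellich

section Operator

variable {Y : Type*} [NormedAddCommGroup Y] [NormedSpace ℂ Y]

/-- The bounded operator `R` is a two-sided inverse of `T - z : D(T) → Y`. -/
def IsResolventAt (T : Y →ₗ.[ℂ] Y) (z : ℂ) (R : Y →L[ℂ] Y) : Prop :=
  (∀ y : Y, ∃ h : R y ∈ T.domain, T ⟨R y, h⟩ - z • R y = y) ∧
    ∀ x : T.domain, R (T x - z • (x : Y)) = x

theorem IsResolventAt.unique {T : Y →ₗ.[ℂ] Y} {z : ℂ} {R S : Y →L[ℂ] Y}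
    (hR : IsResolventAt T z R) (hS : IsResolventAt T z S) : R = S := by
  ext y
  obtain ⟨h, e⟩ := hR.1 y
  have := hS.2 ⟨R y, h⟩
  rw [e] at this
  exact this.symm

/-- The resolvent set `ρ(T)`: all `z` for which `T - z : D(T) → Y` is a bijection with bounded
inverse. -/
def resolventSet (T : Y →ₗ.[ℂ] Y) : Set ℂ :=
  {z | ∃ R : Y →L[ℂ] Y, IsResolventAt T z R}

/-- The spectrum `σ(T)`. -/
def spectrum (T : Y →ₗ.[ℂ] Y) : Set ℂ := (resolventSet T)ᶜ

open Classical in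
/-- The resolvent `(T - z)⁻¹`, for `z ∈ ρ(T)` (and `0` elsewhere). -/
def resolvent (T : Y →ₗ.[ℂ] Y) (z : ℂ) : Y →L[ℂ] Y :=
  if h : ∃ R : Y →L[ℂ] Y, IsResolventAt T z R then h.choose else 0

theorem resolvent_spec {T : Y →ₗ.[ℂ] Y} {z : ℂ} (hz : z ∈ resolventSet T) :
    IsResolventAt T z (resolvent T z) := by
  have h : ∃ R : Y →L[ℂ] Y, IsResolventAt T z R := hz
  rw [resolvent, dif_pos h]
  exact h.choose_spec

/-- `ψ` is an eigenvector of `T` with eigenvalue `E`. -/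
def IsEigenvector (T : Y →ₗ.[ℂ] Y) (E : ℂ) (ψ : Y) : Prop :=
  ψ ≠ 0 ∧ ∃ h : ψ ∈ T.domain, T ⟨ψ, h⟩ = E • ψ

/-- The Riesz integral `-(2πi)⁻¹ ∮_{|z - E| = r} (T - z)⁻¹ dz` over the positively oriented
circle. -/
def rieszProjection (T : Y →ₗ.[ℂ] Y) (E : ℂ) (r : ℝ) : Y →L[ℂ] Y :=
  -((2 * (Real.pi : ℂ) * Complex.I)⁻¹ • ∮ z in C(E, r), resolvent T z)

/-- `E` is an isolated, non-degenerate eigenvalue of `T`: it is an eigenvalue, it is an isolated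
point of the spectrum, and its spectral projection (the Riesz integral over a small circle that
separates `E` from the rest of the spectrum) has one-dimensional range. By Cauchy's theorem the
projection does not depend on the radius. -/
def IsIsolatedNondegenerateEigenvalue (T : Y →ₗ.[ℂ] Y) (E : ℂ) : Prop :=
  (∃ ψ : Y, IsEigenvector T E ψ) ∧
    ∃ r : ℝ, 0 < r ∧ Metric.closedBall E r ∩ spectrum T = {E} ∧
      Module.finrank ℂ (LinearMap.range (rieszProjection T E r : Y →ₗ[ℂ] Y)) = 1

end Operator

/-- Analytic families in the sense of Kato on a set `U` (an open set in all uses); only the values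
`T β` with `β ∈ U` matter. -/
def IsAnalyticFamily {X Y : Type*} [NormedAddCommGroup X] [NormedSpace ℂ X]
    [NormedAddCommGroup Y] [NormedSpace ℂ Y] (U : Set X) (T : X → (Y →ₗ.[ℂ] Y)) : Prop :=
  (∀ β ∈ U, (T β).IsClosed ∧ (resolventSet (T β)).Nonempty) ∧
    ∀ β₀ ∈ U, ∃ z₀ ∈ resolventSet (T β₀), ∃ V : Set X, IsOpen V ∧ β₀ ∈ V ∧ V ⊆ U ∧
      (∀ β ∈ V, z₀ ∈ resolventSet (T β)) ∧
      AnalyticOnNhd ℂ (fun β => resolvent (T β) z₀) V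

end KatoRellich

end

/-!
Near `β₀`, the family is encoded in the bounded operators `A β = (T β - z₀)⁻¹`, which depend
analytically on `β`: a number `z` lies in the resolvent set of `T β` exactly when the pencil
`1 - (z - z₀) A β` is invertible, and then `(T β - z)⁻¹` is `A β` times its inverse
(`IsResolventAt.mem_resolventSet_iff`, `IsResolventAt.resolvent_eq`).

At `β₀` the spectral projection `P` fixes the eigenvector `φ` and has rank one, so `P = ℓ ⊗ φ` with
`ℓ φ = 1`. Integrating `(z - E₀)⁻¹ (1 - (z - z₀) A)⁻¹` over the circle yields an inverse of the
pencil at `E₀` modulo `P`, and therefore the bordered pencil `B = 1 - (z - z₀) A + ℓ ⊗ φ` is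
invertible at `(β₀, E₀)` (`IsIsolatedNondegenerateEigenvalue.exists_isUnit_pencil_add`).

Invertibility is an open condition, so `B` is invertible, with an analytic inverse, for all `(β, z)`
near `(β₀, E₀)`. There the Sherman–Morrison formula reduces the spectrum to the zeros of the scalar
analytic function `1 - ℓ (B⁻¹ φ)` (`IsResolventAt.mem_spectrum_iff_characteristic_eq_zero`). This
function has a simple zero in `z` at the base point, and the analytic implicit function theorem
gives the zero `E β` (`exists_analytic_zero_of_characteristic`). The vector `ψ β = B⁻¹ φ`, evaluated
at `(β, E β)`, is an eigenvector. Since the zero is simple, the resolvent has a simple pole at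
`E β` whose residue has rank one, which is the non-degeneracy of `E β`
(`IsResolventAt.isIsolatedNondegenerateEigenvalue_of_simple_zero`).
-/

open Metric Filter Topology
open scoped ContDiff

noncomputable section

namespace KatoRellich

/-! ### Resolvents through one bounded resolvent -/

section Resolvent

variable {Y : Type*} [NormedAddCommGroup Y] [NormedSpace ℂ Y]

/-- The bounded operator `1 - (z - z₀) A`. For `A = (T - z₀)⁻¹` it is `(T - z)(T - z₀)⁻¹`, and its
invertibility decides whether `z` lies in the resolvent set of `T`. -/
def pencil (A : Y →L[ℂ] Y) (z₀ z : ℂ) : Y →L[ℂ] Y := 1 - (z - z₀) • A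

theorem pencil_apply (A : Y →L[ℂ] Y) (z₀ z : ℂ) (y : Y) :
    pencil A z₀ z y = y - (z - z₀) • A y := rfl

theorem IsResolventAt.apply_resolvent {T : Y →ₗ.[ℂ] Y} {z : ℂ} {R : Y →L[ℂ] Y}
    (hR : IsResolventAt T z R) (y : Y) (h : R y ∈ T.domain) : T ⟨R y, h⟩ = y + z • R y := by
  obtain ⟨_, e⟩ := hR.1 y
  rw [← sub_eq_iff_eq_add]
  exact e

/-- The first resolvent identity. -/
theorem IsResolventAt.sub_eq {T : Y →ₗ.[ℂ] Y} {z w : ℂ} {R S : Y →L[ℂ] Y}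
    (hR : IsResolventAt T z R) (hS : IsResolventAt T w S) : R - S = (z - w) • (S * R) := by
  ext y
  obtain ⟨h, -⟩ := hR.1 y
  have e := hS.2 ⟨R y, h⟩
  rw [hR.apply_resolvent y h] at e
  have e' : y + z • R y - w • R y = y + (z - w) • R y := by module
  simp only [e', map_add, map_smul] at e
  change R y - S y = (z - w) • S (R y)
  rw [sub_eq_iff_eq_add', e]

theorem IsResolventAt.mul_of_pencil {T : Y →ₗ.[ℂ] Y} {z₀ z : ℂ} {A N : Y →L[ℂ] Y}
    (hA : IsResolventAt T z₀ A) (h₁ : pencil A z₀ z * N = 1) (h₂ : N * pencil A z₀ z = 1) :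
    IsResolventAt T z (A * N) := by
  refine ⟨fun y => ?_, fun x => ?_⟩
  · obtain ⟨h, -⟩ := hA.1 (N y)
    refine ⟨h, ?_⟩
    have e := hA.apply_resolvent (N y) h
    have e₁ : pencil A z₀ z (N y) = y := DFunLike.congr_fun h₁ y
    rw [pencil_apply] at e₁
    change T ⟨A (N y), h⟩ - z • A (N y) = y
    rw [e]
    conv_rhs => rw [← e₁]
    module
  · have e := hA.2 x
    have e₂ : N (pencil A z₀ z (T x - z₀ • (x : Y))) = T x - z₀ • (x : Y) := DFunLike.congr_fun h₂ _
    have e₃ : pencil A z₀ z (T x - z₀ • (x : Y)) = T x - z • (x : Y) := by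
      rw [pencil_apply, e]; module
    rw [e₃] at e₂
    change A (N (T x - z • (x : Y))) = x
    rw [e₂, e]

theorem IsResolventAt.isUnit_pencil {T : Y →ₗ.[ℂ] Y} {z₀ z : ℂ} {A R : Y →L[ℂ] Y}
    (hA : IsResolventAt T z₀ A) (hR : IsResolventAt T z R) : IsUnit (pencil A z₀ z) := by
  have h₁ := hR.sub_eq hA
  have h₂ := hA.sub_eq hR
  have h₃ : R - A = (z - z₀) • (R * A) := by
    rw [← neg_sub, h₂]; module
  refine isUnit_iff_exists.2 ⟨1 + (z - z₀) • R, ?_, ?_⟩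
  · have : pencil A z₀ z * (1 + (z - z₀) • R)
        = 1 + (z - z₀) • (R - A - (z - z₀) • (A * R)) := by
      simp only [pencil, sub_mul, mul_add, one_mul, mul_one, smul_mul_assoc, mul_smul_comm]
      module
    rw [this, h₁, sub_self, smul_zero, add_zero]
  · have : (1 + (z - z₀) • R) * pencil A z₀ z
        = 1 + (z - z₀) • (R - A - (z - z₀) • (R * A)) := by
      simp only [pencil, add_mul, mul_sub, one_mul, mul_one, smul_mul_assoc, mul_smul_comm]
      module
    rw [this, h₃, sub_self, smul_zero, add_zero]

theorem IsResolventAt.mem_resolventSet_iff {T : Y →ₗ.[ℂ] Y} {z₀ z : ℂ} {A : Y →L[ℂ] Y}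
    (hA : IsResolventAt T z₀ A) : z ∈ resolventSet T ↔ IsUnit (pencil A z₀ z) :=
  ⟨fun ⟨_, hR⟩ => hA.isUnit_pencil hR, fun h =>
    ⟨_, hA.mul_of_pencil (Ring.mul_inverse_cancel _ h) (Ring.inverse_mul_cancel _ h)⟩⟩

theorem IsResolventAt.resolvent_eq {T : Y →ₗ.[ℂ] Y} {z₀ z : ℂ} {A N : Y →L[ℂ] Y}
    (hA : IsResolventAt T z₀ A) (h₁ : pencil A z₀ z * N = 1) (h₂ : N * pencil A z₀ z = 1) :
    resolvent T z = A * N := by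
  have h := hA.mul_of_pencil h₁ h₂
  exact (resolvent_spec ⟨_, h⟩).unique h

theorem IsResolventAt.isEigenvector_of_pencil_apply_eq_zero {T : Y →ₗ.[ℂ] Y} {z₀ E : ℂ}
    {A : Y →L[ℂ] Y} (hA : IsResolventAt T z₀ A) {ψ : Y} (hψ : ψ ≠ 0)
    (h : pencil A z₀ E ψ = 0) : IsEigenvector T E ψ := by
  rw [pencil_apply, sub_eq_zero] at h
  obtain ⟨hd, -⟩ := hA.1 ((E - z₀) • ψ)
  have e := hA.apply_resolvent _ hd
  have h' : A ((E - z₀) • ψ) = ψ := by rw [map_smul, ← h]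
  refine ⟨hψ, h' ▸ hd, ?_⟩
  have : (⟨ψ, h' ▸ hd⟩ : T.domain) = ⟨_, hd⟩ := Subtype.ext h'.symm
  rw [this, e, h']
  module

theorem IsEigenvector.resolvent_apply {T : Y →ₗ.[ℂ] Y} {E z : ℂ} {ψ : Y} {R : Y →L[ℂ] Y}
    (h : IsEigenvector T E ψ) (hR : IsResolventAt T z R) (hz : z ≠ E) :
    R ψ = (E - z)⁻¹ • ψ := by
  obtain ⟨-, hd, e⟩ := h
  have := hR.2 ⟨ψ, hd⟩
  rw [e] at this
  have e' : E • ψ - z • ψ = (E - z) • ψ := by module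
  simp only [e', map_smul] at this
  rw [eq_inv_smul_iff₀ (sub_ne_zero.2 hz.symm), this]

end Resolvent

/-! ### Circle integrals -/

theorem _root_.ContinuousLinearMap.circleIntegral_comp_comm {F G : Type*}
    [NormedAddCommGroup F] [NormedSpace ℂ F] [CompleteSpace F]
    [NormedAddCommGroup G] [NormedSpace ℂ G] [CompleteSpace G] (L : F →L[ℂ] G)
    {f : ℂ → F} {c : ℂ} {r : ℝ} (hf : CircleIntegrable f c r) :
    (∮ z in C(c, r), L (f z)) = L (∮ z in C(c, r), f z) := by
  simp only [circleIntegral, ← map_smul]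
  exact L.intervalIntegral_comp_comm hf.out

/-- The residue theorem at a simple pole, for an integrand `e⁻¹ f` with `e` scalar and `f`
vector-valued. -/
theorem circleIntegral_inv_smul_of_simple_zero {F : Type*}
    [NormedAddCommGroup F] [NormedSpace ℂ F] [CompleteSpace F] {e : ℂ → ℂ} {f : ℂ → F}
    {U : Set ℂ} (hU : IsOpen U) {c : ℂ} {r : ℝ} (hr : 0 < r) (hc : closedBall c r ⊆ U)
    (he : DifferentiableOn ℂ e U) (hf : DifferentiableOn ℂ f U)
    (h₀ : ∀ z ∈ U, e z = 0 ↔ z = c) (h₁ : deriv e c ≠ 0) :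
    (∮ z in C(c, r), (e z)⁻¹ • f z) = (2 * Real.pi * Complex.I : ℂ) • (deriv e c)⁻¹ • f c := by
  have hcU : c ∈ U := hc (mem_closedBall_self hr.le)
  have hec : e c = 0 := (h₀ c hcU).2 rfl
  have hg : DifferentiableOn ℂ (dslope e c) U :=
    (Complex.differentiableOn_dslope (hU.mem_nhds hcU)).2 he
  have hg₀ : ∀ z ∈ U, dslope e c z ≠ 0 := by
    intro z hz h
    rcases eq_or_ne z c with rfl | hzc
    · exact h₁ (by rwa [dslope_same] at h)
    · have := sub_smul_dslope e c z
      rw [h, hec, smul_zero, sub_zero] at this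
      exact hzc ((h₀ z hz).1 this.symm)
  have hd : DifferentiableOn ℂ (fun z => (dslope e c z)⁻¹ • f z) (closedBall c r) :=
    ((hg.inv hg₀).smul hf).mono hc
  have key := hd.circleIntegral_sub_inv_smul (mem_ball_self hr)
  rw [dslope_same] at key
  rw [← key]
  refine circleIntegral.integral_congr hr.le fun z _ => ?_
  have := sub_smul_dslope e c z
  rw [hec, sub_zero, smul_eq_mul] at this
  simp only [← this, mul_inv, mul_smul]

/-! ### The spectral projection and the bordered pencil at an isolated eigenvalue -/

section Spectral

variable {Y : Type*} [NormedAddCommGroup Y] [NormedSpace ℂ Y]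

theorem continuous_pencil (A : Y →L[ℂ] Y) (z₀ : ℂ) : Continuous (pencil A z₀) := by
  unfold pencil
  fun_prop

variable [CompleteSpace Y]

theorem continuousOn_inverse_pencil {A : Y →L[ℂ] Y} {z₀ : ℂ} {s : Set ℂ}
    (hs : ∀ z ∈ s, IsUnit (pencil A z₀ z)) :
    ContinuousOn (fun z => Ring.inverse (pencil A z₀ z)) s := fun z hz => by
  obtain ⟨u, hu⟩ := hs z hz
  have : ContinuousAt Ring.inverse (pencil A z₀ z) := hu ▸ NormedRing.inverse_continuousAt u
  exact (this.comp (continuous_pencil A z₀).continuousAt).continuousWithinAt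

theorem IsResolventAt.continuousOn_resolvent {T : Y →ₗ.[ℂ] Y} {z₀ : ℂ} {A : Y →L[ℂ] Y}
    (hA : IsResolventAt T z₀ A) : ContinuousOn (resolvent T) (resolventSet T) := by
  have hu : ∀ z ∈ resolventSet T, IsUnit (pencil A z₀ z) := fun z => hA.mem_resolventSet_iff.1
  exact (continuousOn_const.mul (continuousOn_inverse_pencil hu)).congr fun z hz =>
    hA.resolvent_eq (Ring.mul_inverse_cancel _ (hu z hz)) (Ring.inverse_mul_cancel _ (hu z hz))

/-- With `N z = (1 - (z - z₀) A)⁻¹`, the operator `Q = (2πi)⁻¹ ∮ (z - E)⁻¹ N z dz` inverts the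
pencil at `E` up to the spectral projection; this follows by integrating
`pencil A z₀ E * N z = 1 + (z - E) • (A * N z)`. -/
theorem IsResolventAt.exists_inverse_modulo_rieszProjection {T : Y →ₗ.[ℂ] Y} {z₀ E : ℂ}
    {A : Y →L[ℂ] Y} (hA : IsResolventAt T z₀ A) {r : ℝ} (hr : 0 < r)
    (hs : ∀ z ∈ sphere E r, z ∈ resolventSet T) :
    ∃ Q : Y →L[ℂ] Y, pencil A z₀ E * Q = 1 - rieszProjection T E r ∧
      Q * pencil A z₀ E = 1 - rieszProjection T E r := by
  set N : ℂ → Y →L[ℂ] Y := fun z => Ring.inverse (pencil A z₀ z) with hN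
  have hu : ∀ z ∈ sphere E r, IsUnit (pencil A z₀ z) := fun z hz =>
    hA.mem_resolventSet_iff.1 (hs z hz)
  have hne : ∀ z ∈ sphere E r, z - E ≠ 0 := fun z hz =>
    sub_ne_zero.2 (ne_of_mem_sphere hz hr.ne')
  have hMN : ∀ z ∈ sphere E r, pencil A z₀ z * N z = 1 := fun z hz =>
    Ring.mul_inverse_cancel _ (hu z hz)
  have hNM : ∀ z ∈ sphere E r, N z * pencil A z₀ z = 1 := fun z hz =>
    Ring.inverse_mul_cancel _ (hu z hz)
  have hR : ∀ z ∈ sphere E r, resolvent T z = A * N z := fun z hz =>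
    hA.resolvent_eq (hMN z hz) (hNM z hz)
  have hNc : ContinuousOn N (sphere E r) := continuousOn_inverse_pencil hu
  have hic : ContinuousOn (fun z => (z - E)⁻¹) (sphere E r) :=
    (continuousOn_id.sub continuousOn_const).inv₀ hne
  have hi₁ : CircleIntegrable (fun z => (z - E)⁻¹ • (1 : Y →L[ℂ] Y)) E r :=
    (hic.smul continuousOn_const).circleIntegrable hr.le
  have hi₂ : CircleIntegrable (resolvent T) E r :=
    (hA.continuousOn_resolvent.mono hs).circleIntegrable hr.le
  have hi₃ : CircleIntegrable (fun z => (z - E)⁻¹ • N z) E r :=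
    (hic.smul hNc).circleIntegrable hr.le
  have hint : (∮ z in C(E, r), ((z - E)⁻¹ • (1 : Y →L[ℂ] Y) + resolvent T z))
      = (2 * (Real.pi : ℂ) * Complex.I) • (1 - rieszProjection T E r) := by
    rw [circleIntegral.integral_add hi₁ hi₂, circleIntegral.integral_smul_const,
      circleIntegral.integral_sub_center_inv _ hr.ne', rieszProjection, sub_neg_eq_add, smul_add,
      smul_inv_smul₀ Complex.two_pi_I_ne_zero]
  have hE : ∀ z, pencil A z₀ E = pencil A z₀ z + (z - E) • A := fun z => by
    unfold pencil; module
  have hcomm : ∀ z ∈ sphere E r, N z * A = A * N z := fun z hz => by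
    have hc : A * pencil A z₀ z = pencil A z₀ z * A := by
      simp only [pencil, mul_sub, sub_mul, mul_one, one_mul, mul_smul_comm, smul_mul_assoc]
    calc N z * A = N z * A * (pencil A z₀ z * N z) := by rw [hMN z hz, mul_one]
      _ = N z * (A * pencil A z₀ z) * N z := by simp only [mul_assoc]
      _ = A * N z := by rw [hc, ← mul_assoc, hNM z hz, one_mul]
  refine ⟨(2 * (Real.pi : ℂ) * Complex.I)⁻¹ • ∮ z in C(E, r), (z - E)⁻¹ • N z, ?_, ?_⟩
  · rw [mul_smul_comm, inv_smul_eq_iff₀ Complex.two_pi_I_ne_zero, ← hint]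
    have := (ContinuousLinearMap.mul ℂ _ (pencil A z₀ E)).circleIntegral_comp_comm hi₃
    simp only [ContinuousLinearMap.mul_apply'] at this
    rw [← this]
    refine circleIntegral.integral_congr hr.le fun z hz => ?_
    rw [mul_smul_comm, hE z, add_mul, hMN z hz, smul_add, smul_mul_assoc,
      inv_smul_smul₀ (hne z hz), hR z hz]
  · rw [smul_mul_assoc, inv_smul_eq_iff₀ Complex.two_pi_I_ne_zero, ← hint]
    have := ((ContinuousLinearMap.mul ℂ _).flip (pencil A z₀ E)).circleIntegral_comp_comm hi₃
    simp only [ContinuousLinearMap.flip_apply, ContinuousLinearMap.mul_apply'] at this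
    rw [← this]
    refine circleIntegral.integral_congr hr.le fun z hz => ?_
    rw [smul_mul_assoc, hE z, mul_add, hNM z hz, smul_add, mul_smul_comm,
      inv_smul_smul₀ (hne z hz), hcomm z hz, hR z hz]

theorem IsEigenvector.rieszProjection_apply {T : Y →ₗ.[ℂ] Y} {z₀ E : ℂ} {A : Y →L[ℂ] Y}
    {ψ : Y} (h : IsEigenvector T E ψ) (hA : IsResolventAt T z₀ A) {r : ℝ} (hr : 0 < r)
    (hs : ∀ z ∈ sphere E r, z ∈ resolventSet T) : rieszProjection T E r ψ = ψ := by
  have hi : CircleIntegrable (resolvent T) E r :=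
    (hA.continuousOn_resolvent.mono hs).circleIntegrable hr.le
  have key := (ContinuousLinearMap.apply ℂ Y ψ).circleIntegral_comp_comm hi
  simp only [ContinuousLinearMap.apply_apply] at key
  have h₁ : (∮ z in C(E, r), resolvent T z ψ) = -(2 * (Real.pi : ℂ) * Complex.I) • ψ := by
    rw [← circleIntegral.integral_sub_center_inv E hr.ne', ← neg_one_smul ℂ, smul_assoc,
      ← circleIntegral.integral_smul_const, ← circleIntegral.integral_smul]
    refine circleIntegral.integral_congr hr.le fun z hz => ?_
    rw [h.resolvent_apply (resolvent_spec (hs z hz)) (ne_of_mem_sphere hz hr.ne'), ← neg_sub z E,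
      inv_neg]
    module
  change -((2 * (Real.pi : ℂ) * Complex.I)⁻¹ • (∮ z in C(E, r), resolvent T z) ψ) = ψ
  rw [← key, h₁, neg_smul, smul_neg, inv_smul_smul₀ Complex.two_pi_I_ne_zero, neg_neg]

/-- At an isolated non-degenerate eigenvalue the spectral projection is `ℓ ⊗ ψ` with `ψ` an
eigenvector, and adding it to the pencil produces an invertible operator. -/
theorem IsIsolatedNondegenerateEigenvalue.exists_isUnit_pencil_add {T : Y →ₗ.[ℂ] Y}
    {z₀ E : ℂ} {A : Y →L[ℂ] Y} (h : IsIsolatedNondegenerateEigenvalue T E)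
    (hA : IsResolventAt T z₀ A) :
    ∃ (ψ : Y) (ℓ : Y →L[ℂ] ℂ), IsEigenvector T E ψ ∧ ℓ ψ = 1 ∧ pencil A z₀ E ψ = 0 ∧
      IsUnit (pencil A z₀ E + ℓ.smulRight ψ) := by
  obtain ⟨⟨ψ, hψ⟩, r, hr, hσ, hrank⟩ := h
  have hs : ∀ z ∈ sphere E r, z ∈ resolventSet T := fun z hz => by
    by_contra hz'
    exact ne_of_mem_sphere hz hr.ne' (hσ.subset ⟨sphere_subset_closedBall hz, hz'⟩)
  have hPψ := hψ.rieszProjection_apply hA hr hs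
  obtain ⟨Q, hMQ, hQM⟩ := hA.exists_inverse_modulo_rieszProjection hr hs
  set P := rieszProjection T E r with hP
  -- A functional `f` with `f ψ = 1` turns the one-dimensionality of the range of `P`, which
  -- contains `ψ = P ψ`, into the formula `P = (f ∘ P) ⊗ ψ`; idempotence of `P` is then immediate.
  obtain ⟨f, hf⟩ := SeparatingDual.exists_eq_one (R := ℂ) hψ.1
  have hspan : ∀ y, P y = f (P y) • ψ := fun y => by
    obtain ⟨c, hc⟩ := (finrank_eq_one_iff_of_nonzero'
      (⟨ψ, ψ, hPψ⟩ : LinearMap.range (P : Y →ₗ[ℂ] Y))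
      (fun h₀ => hψ.1 (congrArg Subtype.val h₀))).1 hrank ⟨P y, y, rfl⟩
    have hc' : c • ψ = P y := congrArg Subtype.val hc
    rw [← hc', map_smul, hf, smul_eq_mul, mul_one]
  have hPeq : (f ∘L P).smulRight ψ = P := by
    ext y
    exact (hspan y).symm
  have hMψ : pencil A z₀ E ψ = 0 := by
    have hz₀ : z₀ ≠ E := fun e => (hσ.superset rfl : E ∈ _ ∩ _).2 (e ▸ ⟨A, hA⟩)
    rw [pencil_apply, hψ.resolvent_apply hA hz₀, smul_inv_smul₀ (sub_ne_zero.2 hz₀.symm), sub_self]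
  refine ⟨ψ, f ∘L P, hψ, by simp [hPψ, hf], hMψ, ?_⟩
  rw [hPeq]
  have hPP : P * P = P := by
    ext y
    change P (P y) = P y
    rw [hspan y, map_smul, hPψ]
  have hMP : pencil A z₀ E * P = 0 := by
    ext y
    change pencil A z₀ E (P y) = 0
    rw [hspan y, map_smul, hMψ, smul_zero]
  set M := pencil A z₀ E
  have hPM : P * M = 0 := by
    have h₁ : M * (Q * M) = (M * Q) * M := (mul_assoc _ _ _).symm
    rw [hMQ, hQM, mul_sub, sub_mul, one_mul, mul_one, hMP, sub_zero] at h₁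
    exact sub_eq_self.1 h₁.symm
  have hPQ : P * Q = Q * P := by
    have h₁ : Q * (M * Q) = (Q * M) * Q := (mul_assoc _ _ _).symm
    rw [hMQ, hQM, mul_sub, sub_mul, one_mul, mul_one] at h₁
    exact (sub_right_injective h₁).symm
  have hPPQ : P * (P * Q) = P * Q := by rw [← mul_assoc, hPP]
  -- `M` and `Q` are inverse to each other on the range of `1 - P`, and `M + P` is the identity on
  -- the range of `P`, so the inverse is `(1 - P) Q + P`.
  refine isUnit_iff_exists.2 ⟨Q - P * Q + P, ?_, ?_⟩
  · have h₁ : M * (P * Q) = 0 := by rw [← mul_assoc, hMP, zero_mul]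
    rw [add_mul, mul_add, mul_add, mul_sub, mul_sub, hMQ, h₁, hMP, hPPQ, hPP]
    abel
  · have h₁ : P * Q * P = P * Q := by rw [hPQ, mul_assoc, hPP]
    rw [mul_add, add_mul, add_mul, sub_mul, sub_mul, hQM, mul_assoc P Q M, hQM, mul_sub, hPM, h₁,
      hPP, ← hPQ, mul_one]
    abel

end Spectral

/-! ### The bordered pencil and its scalar characteristic function -/

section Bordered

variable {Y : Type*} [NormedAddCommGroup Y] [NormedSpace ℂ Y]

/-- The rank-one perturbation `1 - (z - z₀) A + ℓ ⊗ φ` of the pencil. -/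
def bordered (φ : Y) (ℓ : Y →L[ℂ] ℂ) (A : Y →L[ℂ] Y) (z₀ z : ℂ) : Y →L[ℂ] Y :=
  pencil A z₀ z + ℓ.smulRight φ

/-- The scalar `1 - ℓ (B⁻¹ φ)`, with `B` the bordered pencil. Where `B` is invertible, this is the
determinant of `B⁻¹ (B - ℓ ⊗ φ)`, so it vanishes exactly where the pencil is not invertible. -/
def characteristic (φ : Y) (ℓ : Y →L[ℂ] ℂ) (A : Y →L[ℂ] Y) (z₀ z : ℂ) : ℂ :=
  1 - ℓ (Ring.inverse (bordered φ ℓ A z₀ z) φ)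

variable {φ : Y} {ℓ : Y →L[ℂ] ℂ} {A : Y →L[ℂ] Y} {z₀ z : ℂ}

theorem pencil_eq_bordered_sub : pencil A z₀ z = bordered φ ℓ A z₀ z - ℓ.smulRight φ :=
  (add_sub_cancel_right _ _).symm

theorem pencil_apply_inverse_bordered (hB : IsUnit (bordered φ ℓ A z₀ z)) :
    pencil A z₀ z (Ring.inverse (bordered φ ℓ A z₀ z) φ) = characteristic φ ℓ A z₀ z • φ := by
  have h : bordered φ ℓ A z₀ z (Ring.inverse (bordered φ ℓ A z₀ z) φ) = φ :=
    DFunLike.congr_fun (Ring.mul_inverse_cancel _ hB) φ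
  rw [pencil_eq_bordered_sub (φ := φ) (ℓ := ℓ)]
  change bordered φ ℓ A z₀ z (Ring.inverse (bordered φ ℓ A z₀ z) φ)
    - ℓ (Ring.inverse (bordered φ ℓ A z₀ z) φ) • φ = _
  rw [h, characteristic]
  module

/-- The Sherman–Morrison formula for the inverse of the pencil. -/
theorem pencil_inverse_formula (hB : IsUnit (bordered φ ℓ A z₀ z))
    (hc : characteristic φ ℓ A z₀ z ≠ 0) {N : Y →L[ℂ] Y}
    (hN : N = Ring.inverse (bordered φ ℓ A z₀ z) + (characteristic φ ℓ A z₀ z)⁻¹ •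
      (Ring.inverse (bordered φ ℓ A z₀ z) * ℓ.smulRight φ *
        Ring.inverse (bordered φ ℓ A z₀ z))) :
    pencil A z₀ z * N = 1 ∧ N * pencil A z₀ z = 1 := by
  have h₁ := Ring.mul_inverse_cancel _ hB
  have h₂ := Ring.inverse_mul_cancel _ hB
  have hPGP : ℓ.smulRight φ * Ring.inverse (bordered φ ℓ A z₀ z) * ℓ.smulRight φ
      = (1 - characteristic φ ℓ A z₀ z) • ℓ.smulRight φ := by
    ext y
    change ℓ (Ring.inverse (bordered φ ℓ A z₀ z) (ℓ y • φ)) • φ = _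
    simp only [map_smul, characteristic, sub_sub_cancel]
    change _ = ℓ (Ring.inverse (bordered φ ℓ A z₀ z) φ) • ℓ y • φ
    rw [smul_eq_mul, mul_comm, mul_smul]
  rw [hN, pencil_eq_bordered_sub (φ := φ) (ℓ := ℓ)]
  set B := bordered φ ℓ A z₀ z
  set G := Ring.inverse B
  set P := ℓ.smulRight φ
  set e := characteristic φ ℓ A z₀ z
  have h₃ : P * (G * P * G) = (1 - e) • (P * G) := by
    rw [← smul_mul_assoc, ← hPGP]; simp only [mul_assoc]
  have h₄ : G * P * G * P = (1 - e) • (G * P) := by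
    rw [← mul_smul_comm, ← hPGP]; simp only [mul_assoc]
  have h₅ : B * (G * P * G) = P * G := by rw [← mul_assoc, ← mul_assoc, h₁, one_mul]
  have h₆ : G * P * G * B = G * P := by rw [mul_assoc, h₂, mul_one]
  have h₇ : e⁻¹ * (1 - e) = e⁻¹ - 1 := by field_simp
  constructor
  · rw [mul_add, mul_smul_comm, sub_mul, sub_mul, h₁, h₃, h₅, smul_sub, smul_smul, h₇]
    module
  · rw [add_mul, smul_mul_assoc, mul_sub, mul_sub, h₂, h₄, h₆, smul_sub, smul_smul, h₇]
    module

theorem inverse_bordered_apply_ne_zero (hc : characteristic φ ℓ A z₀ z = 0) :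
    Ring.inverse (bordered φ ℓ A z₀ z) φ ≠ 0 := fun h => by
  rw [characteristic, h, map_zero, sub_zero] at hc
  exact one_ne_zero hc

theorem IsResolventAt.mem_spectrum_iff_characteristic_eq_zero {T : Y →ₗ.[ℂ] Y}
    (hA : IsResolventAt T z₀ A) (hB : IsUnit (bordered φ ℓ A z₀ z)) :
    z ∈ spectrum T ↔ characteristic φ ℓ A z₀ z = 0 := by
  rw [spectrum, Set.mem_compl_iff, hA.mem_resolventSet_iff, not_iff_comm]
  refine ⟨fun hc => isUnit_iff_exists.2 ⟨_, pencil_inverse_formula hB hc rfl⟩, fun hu hc => ?_⟩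
  have h := pencil_apply_inverse_bordered hB
  rw [hc, zero_smul] at h
  refine inverse_bordered_apply_ne_zero hc ?_
  have h₂ := DFunLike.congr_fun (Ring.inverse_mul_cancel _ hu)
    (Ring.inverse (bordered φ ℓ A z₀ z) φ)
  change Ring.inverse (pencil A z₀ z) (pencil A z₀ z _) = _ at h₂
  rw [h, map_zero] at h₂
  exact h₂.symm

variable [CompleteSpace Y]

theorem hasDerivAt_inverse_bordered (hB : IsUnit (bordered φ ℓ A z₀ z)) :
    HasDerivAt (fun w => Ring.inverse (bordered φ ℓ A z₀ w))
      (Ring.inverse (bordered φ ℓ A z₀ z) * A * Ring.inverse (bordered φ ℓ A z₀ z)) z := by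
  have h₁ := hasFDerivAt_ringInverse (𝕜 := ℂ) hB.unit
  have h₂ : HasDerivAt (fun w => bordered φ ℓ A z₀ w) (-A) z := by
    have : HasDerivAt (fun w : ℂ => (w - z₀) • A) ((1 : ℂ) • A) z :=
      ((hasDerivAt_id z).sub_const z₀).smul_const A
    simpa [bordered, pencil] using (this.const_sub 1).add_const (ℓ.smulRight φ)
  have h₃ := HasFDerivAt.comp_hasDerivAt (f := fun w => bordered φ ℓ A z₀ w) z h₁ h₂
  simpa [Function.comp_def, ← Ring.inverse_unit hB.unit] using h₃

theorem hasDerivAt_characteristic (hB : IsUnit (bordered φ ℓ A z₀ z)) :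
    HasDerivAt (characteristic φ ℓ A z₀)
      (-ℓ (Ring.inverse (bordered φ ℓ A z₀ z)
        (A (Ring.inverse (bordered φ ℓ A z₀ z) φ)))) z := by
  have h := ((ℓ ∘L ContinuousLinearMap.apply ℂ Y φ).hasFDerivAt.comp_hasDerivAt z
    (hasDerivAt_inverse_bordered hB)).const_sub 1
  exact h

/-- A simple zero of the characteristic function is an isolated non-degenerate eigenvalue: by the
Sherman–Morrison formula the resolvent has a simple pole there, with a residue of rank one. -/
theorem IsResolventAt.isIsolatedNondegenerateEigenvalue_of_simple_zero {T : Y →ₗ.[ℂ] Y}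
    (hA : IsResolventAt T z₀ A) {U : Set ℂ} (hU : IsOpen U) {E : ℂ} (hE : E ∈ U)
    (hB : ∀ z ∈ U, IsUnit (bordered φ ℓ A z₀ z))
    (h₀ : ∀ z ∈ U, characteristic φ ℓ A z₀ z = 0 ↔ z = E)
    (h₁ : ℓ (Ring.inverse (bordered φ ℓ A z₀ E)
        (A (Ring.inverse (bordered φ ℓ A z₀ E) φ))) ≠ 0) :
    IsEigenvector T E (Ring.inverse (bordered φ ℓ A z₀ E) φ) ∧
      IsIsolatedNondegenerateEigenvalue T E := by
  have hE₀ : characteristic φ ℓ A z₀ E = 0 := (h₀ E hE).2 rfl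
  have hev : IsEigenvector T E (Ring.inverse (bordered φ ℓ A z₀ E) φ) := by
    refine hA.isEigenvector_of_pencil_apply_eq_zero (inverse_bordered_apply_ne_zero hE₀) ?_
    rw [pencil_apply_inverse_bordered (hB E hE), hE₀, zero_smul]
  refine ⟨hev, ⟨_, hev⟩, ?_⟩
  obtain ⟨r, hr, hrU⟩ := nhds_basis_closedBall.mem_iff.1 (hU.mem_nhds hE)
  refine ⟨r, hr, ?_, ?_⟩
  · ext z
    rw [Set.mem_inter_iff, Set.mem_singleton_iff]
    constructor
    · rintro ⟨hz, hσ⟩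
      exact (h₀ z (hrU hz)).1
        ((hA.mem_spectrum_iff_characteristic_eq_zero (hB z (hrU hz))).1 hσ)
    · rintro rfl
      exact ⟨mem_closedBall_self hr.le,
        (hA.mem_spectrum_iff_characteristic_eq_zero (hB z hE)).2 hE₀⟩
  set G : ℂ → Y →L[ℂ] Y := fun z => Ring.inverse (bordered φ ℓ A z₀ z) with hG
  have hGd : DifferentiableOn ℂ G U := fun z hz =>
    (hasDerivAt_inverse_bordered (hB z hz)).differentiableAt.differentiableWithinAt
  have hed : DifferentiableOn ℂ (characteristic φ ℓ A z₀) U := fun z hz =>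
    (hasDerivAt_characteristic (hB z hz)).differentiableAt.differentiableWithinAt
  have hAG : DifferentiableOn ℂ (fun z => A * G z) U := hGd.const_mul A
  have hF : DifferentiableOn ℂ (fun z => A * (G z * ℓ.smulRight φ * G z)) U :=
    ((hGd.mul_const _).mul hGd).const_mul A
  have hde := (hasDerivAt_characteristic (hB E hE)).deriv
  have hde₀ : deriv (characteristic φ ℓ A z₀) E ≠ 0 := by
    rw [hde]; exact neg_ne_zero.2 h₁
  have hcne : ∀ z ∈ sphere E r, characteristic φ ℓ A z₀ z ≠ 0 := fun z hz h =>
    ne_of_mem_sphere hz hr.ne' ((h₀ z (hrU (sphere_subset_closedBall hz))).1 h)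
  have hsub : sphere E r ⊆ U := sphere_subset_closedBall.trans hrU
  -- The resolvent is `A G + e⁻¹ A G (ℓ ⊗ φ) G`, with `e` the characteristic function; the first
  -- summand is holomorphic on the disc and contributes nothing to the integral.
  have hint : (∮ z in C(E, r), resolvent T z) = (2 * Real.pi * Complex.I : ℂ) •
      (deriv (characteristic φ ℓ A z₀) E)⁻¹ • (A * (G E * ℓ.smulRight φ * G E)) := by
    rw [← circleIntegral_inv_smul_of_simple_zero hU hr hrU hed hF h₀ hde₀,
      ← zero_add (∮ z in C(E, r), _⁻¹ • _),
      ← ((hAG.mono hrU).mono closure_ball_subset_closedBall).diffContOnCl.circleIntegral_eq_zero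
        hr.le, ← circleIntegral.integral_add]
    · refine circleIntegral.integral_congr hr.le fun z hz => ?_
      have hN := pencil_inverse_formula (hB z (hsub hz)) (hcne z hz) rfl
      rw [hA.resolvent_eq hN.1 hN.2, mul_add, mul_smul_comm]
    · exact (hAG.continuousOn.mono hsub).circleIntegrable hr.le
    · exact (((hed.continuousOn.mono hsub).inv₀ hcne).smul
        (hF.continuousOn.mono hsub)).circleIntegrable hr.le
  set c : ℂ := -(deriv (characteristic φ ℓ A z₀) E)⁻¹ with hc
  have hc₀ : c ≠ 0 := neg_ne_zero.2 (inv_ne_zero hde₀)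
  have hproj : ∀ y, rieszProjection T E r y = (c * ℓ (G E y)) • A (G E φ) := fun y => by
    rw [rieszProjection, hint, inv_smul_smul₀ Complex.two_pi_I_ne_zero, ← neg_smul, ← hc]
    change c • A (G E (ℓ (G E y) • φ)) = _
    rw [map_smul, map_smul, smul_smul]
  -- The value at `φ` is `c • A (G E φ)`, since `ℓ (G E φ) = 1` at the zero `E`.
  have hφ : ℓ (G E φ) = 1 := (sub_eq_zero.1 hE₀).symm
  have hv : A (G E φ) ≠ 0 := fun h => h₁ (by
    change ℓ (G E (A (G E φ))) = 0
    rw [h, map_zero, map_zero])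
  have hrange : LinearMap.range (rieszProjection T E r : Y →ₗ[ℂ] Y)
      = Submodule.span ℂ {A (G E φ)} := by
    ext x
    rw [Submodule.mem_span_singleton, LinearMap.mem_range]
    constructor
    · rintro ⟨y, rfl⟩
      exact ⟨_, (hproj y).symm⟩
    · rintro ⟨a, rfl⟩
      refine ⟨(a * c⁻¹) • φ, ?_⟩
      change rieszProjection T E r _ = _
      rw [hproj, map_smul, map_smul, hφ, smul_eq_mul, mul_one]
      congr 1
      field_simp
  rw [hrange, finrank_span_singleton hv]

end Bordered

/-! ### Dependence on the parameter -/

section Parameter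

variable {X Y : Type*} [NormedAddCommGroup X] [NormedSpace ℂ X]
  [NormedAddCommGroup Y] [NormedSpace ℂ Y]

theorem analyticAt_inverse_bordered [CompleteSpace Y] {φ : Y} {ℓ : Y →L[ℂ] ℂ} {z₀ : ℂ}
    {A : X → Y →L[ℂ] Y} {p : X × ℂ} (hA : AnalyticAt ℂ A p.1)
    (hB : IsUnit (bordered φ ℓ (A p.1) z₀ p.2)) :
    AnalyticAt ℂ (fun q : X × ℂ => Ring.inverse (bordered φ ℓ (A q.1) z₀ q.2)) p := by
  have h₁ : AnalyticAt ℂ (fun q : X × ℂ => bordered φ ℓ (A q.1) z₀ q.2) p :=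
    (analyticAt_const.sub ((analyticAt_snd.sub analyticAt_const).smul
      (hA.fun_comp analyticAt_fst))).add analyticAt_const
  exact AnalyticAt.fun_comp (g := Ring.inverse) (analyticAt_inverse (𝕜 := ℂ) hB.unit) h₁

/-- The implicit function theorem for an analytic scalar equation `e (β, z) = 0` with a simple
zero in `z`. -/
theorem _root_.AnalyticAt.exists_implicitFunction_of_hasDerivAt [CompleteSpace X]
    {e : X × ℂ → ℂ} {β₀ : X} {E₀ d : ℂ} (he : AnalyticAt ℂ e (β₀, E₀)) (he₀ : e (β₀, E₀) = 0)
    (hd : HasDerivAt (fun z => e (β₀, z)) d E₀) (hd₀ : d ≠ 0) :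
    ∃ E : X → ℂ, E β₀ = E₀ ∧ AnalyticAt ℂ E β₀ ∧
      ∀ᶠ p in 𝓝 (β₀, E₀), e p = 0 ↔ E p.1 = p.2 := by
  have hinv : (fderiv ℂ e (β₀, E₀) ∘L .inr ℂ X ℂ).IsInvertible := by
    have h₁ : HasDerivAt (fun z => e (β₀, z)) (fderiv ℂ e (β₀, E₀) (0, 1)) E₀ :=
      he.differentiableAt.hasFDerivAt.comp_hasDerivAt E₀
        ((hasDerivAt_const E₀ β₀).prodMk (hasDerivAt_id E₀))
    have h₂ : fderiv ℂ e (β₀, E₀) (0, 1) ≠ 0 := h₁.unique hd ▸ hd₀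
    refine ⟨ContinuousLinearEquiv.unitsEquivAut ℂ (Units.mk0 _ h₂), ?_⟩
    ext
    simp
  have hcd : ContDiffAt ℂ ω e (β₀, E₀) := he.contDiffAt
  have hω : (ω : WithTop ℕ∞) ≠ 0 := by simp
  have han : ContDiffAt ℂ ω (hcd.implicitFunction hω hinv) β₀ :=
    hcd.contDiffAt_implicitFunction hω hinv
  have himp := hcd.eventually_apply_eq_iff_implicitFunction hω hinv
  rw [he₀] at himp
  exact ⟨_, hcd.implicitFunction_apply_self hω hinv, han.analyticAt, himp⟩

/-- The bordered pencil stays invertible near `(β₀, E₀)`, and the zeros of its characteristic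
function form the graph of an analytic function `E`, along which they remain simple. -/
theorem exists_analytic_zero_of_characteristic [CompleteSpace X] [CompleteSpace Y]
    {φ : Y} {ℓ : Y →L[ℂ] ℂ} {z₀ E₀ : ℂ} {β₀ : X} {A : X → Y →L[ℂ] Y} (hA : AnalyticAt ℂ A β₀)
    (hℓφ : ℓ φ = 1) (hMφ : pencil (A β₀) z₀ E₀ φ = 0)
    (hB : IsUnit (bordered φ ℓ (A β₀) z₀ E₀)) :
    ∃ E : X → ℂ, E β₀ = E₀ ∧ AnalyticAt ℂ E β₀ ∧
      ∀ᶠ p : X × ℂ in 𝓝 (β₀, E₀), IsUnit (bordered φ ℓ (A p.1) z₀ p.2) ∧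
        (characteristic φ ℓ (A p.1) z₀ p.2 = 0 ↔ p.2 = E p.1) ∧
        ℓ (Ring.inverse (bordered φ ℓ (A p.1) z₀ p.2)
          (A p.1 (Ring.inverse (bordered φ ℓ (A p.1) z₀ p.2) φ))) ≠ 0 := by
  have hG : AnalyticAt ℂ (fun q : X × ℂ => Ring.inverse (bordered φ ℓ (A q.1) z₀ q.2))
      (β₀, E₀) := analyticAt_inverse_bordered hA hB
  have he : AnalyticAt ℂ (fun q : X × ℂ => characteristic φ ℓ (A q.1) z₀ q.2) (β₀, E₀) :=
    analyticAt_const.sub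
      ((ℓ ∘L ContinuousLinearMap.apply ℂ Y φ).analyticAt _ |>.fun_comp hG)
  -- At the base point `B φ = φ`, hence the characteristic function vanishes there and its
  -- derivative is `-ℓ (A φ) = -(E₀ - z₀)⁻¹`.
  have hBφ : bordered φ ℓ (A β₀) z₀ E₀ φ = φ := by
    change pencil (A β₀) z₀ E₀ φ + ℓ φ • φ = φ
    rw [hMφ, hℓφ, zero_add, one_smul]
  have hGφ : Ring.inverse (bordered φ ℓ (A β₀) z₀ E₀) φ = φ := by
    have : Ring.inverse (bordered φ ℓ (A β₀) z₀ E₀) (bordered φ ℓ (A β₀) z₀ E₀ φ) = φ :=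
      DFunLike.congr_fun (Ring.inverse_mul_cancel _ hB) φ
    rwa [hBφ] at this
  have he₀ : characteristic φ ℓ (A β₀) z₀ E₀ = 0 := by
    rw [characteristic, hGφ, hℓφ, sub_self]
  have hd₀ : ℓ (Ring.inverse (bordered φ ℓ (A β₀) z₀ E₀)
      (A β₀ (Ring.inverse (bordered φ ℓ (A β₀) z₀ E₀) φ))) ≠ 0 := by
    intro h₀
    have h : φ = (E₀ - z₀) • A β₀ φ := sub_eq_zero.1 hMφ
    rw [hGφ] at h₀
    have h₁ : ℓ (Ring.inverse (bordered φ ℓ (A β₀) z₀ E₀) ((E₀ - z₀) • A β₀ φ)) = 0 := by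
      rw [map_smul, map_smul, h₀, smul_zero]
    rw [← h, hGφ, hℓφ] at h₁
    exact one_ne_zero h₁
  have hd : HasDerivAt (fun z => characteristic φ ℓ (A β₀) z₀ z) _ E₀ :=
    hasDerivAt_characteristic hB
  obtain ⟨E, hEβ₀, hEan, himp⟩ := AnalyticAt.exists_implicitFunction_of_hasDerivAt
    (e := fun q : X × ℂ => characteristic φ ℓ (A q.1) z₀ q.2) he he₀ hd (neg_ne_zero.2 hd₀)
  refine ⟨E, hEβ₀, hEan, ?_⟩
  have hAc : ContinuousAt (fun p : X × ℂ => A p.1) (β₀, E₀) :=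
    ContinuousAt.comp' (f := Prod.fst) hA.continuousAt continuousAt_fst
  have hBc : ContinuousAt (fun p : X × ℂ => bordered φ ℓ (A p.1) z₀ p.2) (β₀, E₀) :=
    (continuousAt_const.sub ((continuousAt_snd.sub continuousAt_const).smul hAc)).add
      continuousAt_const
  have hdc : ContinuousAt (fun p : X × ℂ => ℓ (Ring.inverse (bordered φ ℓ (A p.1) z₀ p.2)
      (A p.1 (Ring.inverse (bordered φ ℓ (A p.1) z₀ p.2) φ)))) (β₀, E₀) :=
    ContinuousAt.comp' ℓ.continuous.continuousAt
      (hG.continuousAt.clm_apply (hAc.clm_apply (hG.continuousAt.clm_apply continuousAt_const)))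
  filter_upwards [hBc.eventually (Units.isOpen.mem_nhds hB), himp, hdc.eventually_ne hd₀]
    with p h₁ h₂ h₃
  exact ⟨h₁, h₂.trans eq_comm, h₃⟩

end Parameter

end KatoRellich

theorem mainTheorem1 {X Y : Type*}
    [NormedAddCommGroup X] [NormedSpace ℂ X] [CompleteSpace X]
    [NormedAddCommGroup Y] [NormedSpace ℂ Y] [CompleteSpace Y]
    (U : Set X) (hU : IsOpen U) (hUc : IsConnected U)
    (T : X → (Y →ₗ.[ℂ] Y)) (hT : KatoRellich.IsAnalyticFamily U T)
    (β₀ : X) (hβ₀ : β₀ ∈ U) (E₀ : ℂ)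
    (hE₀ : KatoRellich.IsIsolatedNondegenerateEigenvalue (T β₀) E₀) :
    ∃ r : ℝ, 0 < r ∧ ∃ W : Set X, IsOpen W ∧ β₀ ∈ W ∧ W ⊆ U ∧
      ∃ (E : X → ℂ) (ψ : X → Y),
        E β₀ = E₀ ∧
        (∀ β ∈ W, KatoRellich.spectrum (T β) ∩ Metric.ball E₀ r = {E β} ∧
          KatoRellich.IsIsolatedNondegenerateEigenvalue (T β) (E β)) ∧
        AnalyticOnNhd ℂ E W ∧
        (∀ β ∈ W, KatoRellich.IsEigenvector (T β) (E β) (ψ β)) ∧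
        AnalyticOnNhd ℂ ψ W := by
  open KatoRellich in
  obtain ⟨z₀, -, V, hVo, hβ₀V, hVU, hzV, hAV⟩ := hT.2 β₀ hβ₀
  have hA : ∀ β ∈ V, IsResolventAt (T β) z₀ (resolvent (T β) z₀) := fun β hβ =>
    resolvent_spec (hzV β hβ)
  -- Only analyticity of `β ↦ (T β - z₀)⁻¹` and the resolvent property matter from here on.
  generalize hAdef : (fun β => resolvent (T β) z₀) = A at hAV
  replace hA : ∀ β ∈ V, IsResolventAt (T β) z₀ (A β) := fun β hβ => by
    rw [← hAdef]
    exact hA β hβ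
  obtain ⟨φ, ℓ, -, hℓφ, hMφ, hB₀⟩ := hE₀.exists_isUnit_pencil_add (hA β₀ hβ₀V)
  obtain ⟨E, hEβ₀, hEan, hev⟩ :=
    exists_analytic_zero_of_characteristic (hAV β₀ hβ₀V) hℓφ hMφ hB₀
  rw [nhds_prod_eq, ((Filter.basis_sets _).prod nhds_basis_ball).eventually_iff] at hev
  obtain ⟨⟨S, r⟩, ⟨hS, hr⟩, hSr⟩ := hev
  have hW : ∀ᶠ β in 𝓝 β₀, β ∈ S ∧ β ∈ V ∧ AnalyticAt ℂ E β ∧ E β ∈ ball E₀ r := by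
    filter_upwards [hS, hVo.mem_nhds hβ₀V, hEan.eventually_analyticAt,
      hEan.continuousAt.eventually (by rw [hEβ₀]; exact ball_mem_nhds E₀ hr)]
      with β h₁ h₂ h₃ h₄ using ⟨h₁, h₂, h₃, h₄⟩
  obtain ⟨W, hWsub, hWo, hβ₀W⟩ := _root_.eventually_nhds_iff.1 hW
  have hall : ∀ β ∈ W, ∀ z ∈ ball E₀ r, IsUnit (bordered φ ℓ (A β) z₀ z) ∧
      (characteristic φ ℓ (A β) z₀ z = 0 ↔ z = E β) ∧
      ℓ (Ring.inverse (bordered φ ℓ (A β) z₀ z)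
        (A β (Ring.inverse (bordered φ ℓ (A β) z₀ z) φ))) ≠ 0 := fun β hβ z hz =>
    hSr (x := (β, z)) ⟨(hWsub β hβ).1, hz⟩
  have hslice : ∀ β ∈ W,
      IsEigenvector (T β) (E β) (Ring.inverse (bordered φ ℓ (A β) z₀ (E β)) φ) ∧
        IsIsolatedNondegenerateEigenvalue (T β) (E β) := fun β hβ =>
    have ⟨_, hβV, _, hEb⟩ := hWsub β hβ
    (hA β hβV).isIsolatedNondegenerateEigenvalue_of_simple_zero isOpen_ball hEb
      (fun z hz => (hall β hβ z hz).1) (fun z hz => (hall β hβ z hz).2.1) (hall β hβ _ hEb).2.2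
  refine ⟨r, hr, W, hWo, hβ₀W, fun β hβ => hVU (hWsub β hβ).2.1, E,
    fun β => Ring.inverse (bordered φ ℓ (A β) z₀ (E β)) φ, hEβ₀,
    fun β hβ => ⟨?_, (hslice β hβ).2⟩, fun β hβ => (hWsub β hβ).2.2.1,
    fun β hβ => (hslice β hβ).1, fun β hβ => ?_⟩
  · obtain ⟨-, hβV, -, hEb⟩ := hWsub β hβ
    have key : ∀ z ∈ ball E₀ r, z ∈ spectrum (T β) ↔ z = E β := fun z hz =>
      ((hA β hβV).mem_spectrum_iff_characteristic_eq_zero (hall β hβ z hz).1).trans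
        (hall β hβ z hz).2.1
    ext z
    rw [Set.mem_inter_iff, Set.mem_singleton_iff]
    constructor
    · rintro ⟨hσ, hz⟩
      exact (key z hz).1 hσ
    · rintro rfl
      exact ⟨(key _ hEb).2 rfl, hEb⟩
  · obtain ⟨-, hβV, hEa, hEb⟩ := hWsub β hβ
    have h₁ : AnalyticAt ℂ (fun β => Ring.inverse (bordered φ ℓ (A β) z₀ (E β))) β :=
      AnalyticAt.fun_comp (f := fun β => (β, E β))
        (analyticAt_inverse_bordered (p := (β, E β)) (hAV β hβV) (hall β hβ _ hEb).1)
        (analyticAt_id.prod hEa)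
    exact ((ContinuousLinearMap.apply ℂ Y φ).analyticAt _).fun_comp h₁

end
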